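/- Let $K$ be an algebraically closed field and let $A$ be an associative unital $K$-algebra of finite dimension over $K$ and of finite global dimension, i.e. there is an $N \in \mathbb{N}$ such that every left $A$-module has a projective resolution that vanishes in degrees above $N$. Let $(P_i)_{i \in I}$ be representatives of the isomorphism classes of indecomposable projective left $A$-modules and $(S_i)_{i \in I}$ representatives of the isomorphism classes of simple left $A$-modules, indexed by the same set $I$ in such a way that $S_i$ is a quotient of $P_i$ for every $i \in I$. Then $I$ is finite, all the spaces $\operatorname{Hom}_A(P_i, P_j)$ and $\operatorname{Ext}^n_A(S_i, S_j)$ are finite-dimensional over $K$, and there is an $N$ with $\operatorname{Ext}^n_A(S_i, S_j) = 0$ for all $i, j \in I$ and all $n > N$, so that the Cartan matrix $Z_A = (Z_{ij})_{i,j \in I}$ and the Euler matrix $E_A = (E_{ij})_{i,j \in I}$ given by \[ Z_{ij} = \dim_K \operatorname{Hom}_A(P_i, P_j), \qquad E_{ij} = \chi_A(S_j, S_i), \qquad \chi_A(X, Y) = \sum_{n = 0}^{\infty} (-1)^n \dim_K \operatorname{Ext}^n_A(X, Y) \] are well-defined integer matrices. Moreover, $Z_A$ is invertible over $\mathbb{Z}$,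 and its inverse is $E_A$. -/

import Mathlib

open CategoryTheory CategoryTheory.Abelian

universe u v w

noncomputable section

/-- A ring `A` has finite (left) global dimension: there is a bound `N` such that every left
`A`-module has a projective resolution that is zero in degrees above `N`. -/
def HasFiniteGlobalDimension (A : Type u) [Ring A] : Prop :=
  ∃ N : ℕ, ∀ X : ModuleCat.{u} A, ∃ Q : ProjectiveResolution X,
    ∀ n : ℕ, N < n → Limits.IsZero (Q.complex.X n)

/-- The family `X` is a family of representatives of the isomorphism classes of those objects
of `C` that satisfy `p`: each such object is isomorphic to exactly one `X i`. -/
structure IsFamilyOfRepresentatives {C : Type u} [Category.{v} C] {I : Type w}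
    (p : C → Prop) (X : I → C) : Prop where
  prop : ∀ i, p (X i)
  eq_of_iso : ∀ i j, Nonempty (X i ≅ X j) → i = j
  exists_iso : ∀ Y : C, p Y → ∃ i, Nonempty (Y ≅ X i)

/-- The Euler form `χ_A(X, Y) = ∑ₙ (-1)ⁿ dim_K Extⁿ_A(X, Y)`. -/
def eulerForm (K : Type v) [Field K] {A : Type u} [Ring A] [Algebra K A]
    (X Y : ModuleCat.{u} A) : ℤ :=
  ∑ᶠ n : ℕ, (-1) ^ n * (Module.finrank K (Ext X Y n) : ℤ)

/-- The Cartan matrix `Z_A`, with entries `dim_K Hom_A(P i, P j)`. -/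
def cartanMatrix (K : Type v) [Field K] {A : Type u} [Ring A] [Algebra K A] {I : Type w}
    (P : I → ModuleCat.{u} A) : Matrix I I ℤ :=
  Matrix.of fun i j => (Module.finrank K (P i ⟶ P j) : ℤ)

/-- The Euler matrix `E_A`, with `(i, j)`-entry `χ_A(S j, S i)`. -/
def eulerMatrix (K : Type v) [Field K] {A : Type u} [Ring A] [Algebra K A] {I : Type w}
    (S : I → ModuleCat.{u} A) : Matrix I I ℤ :=
  Matrix.of fun i j => eulerForm K (S j) (S i)

end

/-! ### Fitting's lemma and uniqueness of projective covers of simple modules. -/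

section Indecomposable

variable {A : Type u} [Ring A]

/-! Over an algebraically closed field `dim Hom(P i, S j)` is `1` if `i = j` and `0` otherwise
(`IsFamilyOfRepresentatives.finrank_hom`). As `Hom(P i, -)` is exact, `dim Hom(P i, X)` is therefore
the multiplicity of `S i` in a finite-dimensional `X`. The Euler form is additive in its first
argument, so `χ(X, Y) = ∑ i, dim Hom(P i, X) * χ(S i, Y)` (`eulerForm_eq_sum_finrank_hom`). For `X =
P j` and `Y = S k` the left side is `dim Hom(P j, S k)`, and the formula reads `E * Z = 1`.

The `P i` are not assumed finitely generated. Each `S i` has a finite-dimensional indecomposable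
projective cover, and Fitting's lemma identifies it with `P i`. -/

/-- Complementary submodules of an indecomposable module are trivial. -/
theorem CategoryTheory.Indecomposable.eq_bot_or_eq_bot_of_isCompl {X : ModuleCat.{u} A}
    (hX : Indecomposable X) {p q : Submodule A X} (hpq : IsCompl p q) : p = ⊥ ∨ q = ⊥ := by
  have e : X ≅ ModuleCat.of A p ⊞ ModuleCat.of A q :=
    (Submodule.prodEquivOfIsCompl p q hpq).symm.toModuleIso ≪≫
      (ModuleCat.biprodIsoProd (ModuleCat.of A p) (ModuleCat.of A q)).symm
  refine (hX.2 _ _ e).imp (fun h => ?_) (fun h => ?_)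
  · have := ModuleCat.subsingleton_of_isZero h
    exact Submodule.subsingleton_iff_eq_bot.mp this
  · have := ModuleCat.subsingleton_of_isZero h
    exact Submodule.subsingleton_iff_eq_bot.mp this

/-- Fitting's lemma. -/
theorem CategoryTheory.Indecomposable.isUnit_or_isNilpotent {X : ModuleCat.{u} A}
    [IsArtinian A X] [IsNoetherian A X] (hX : Indecomposable X) (f : Module.End A X) :
    IsUnit f ∨ IsNilpotent f := by
  -- `n ≥ 1` is needed: injectivity of `f ^ 0` says nothing about `f`.
  obtain ⟨n, hn, hn1⟩ := ((LinearMap.eventually_isCompl_ker_pow_range_pow f).and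
    (Filter.eventually_ge_atTop 1)).exists
  rcases hX.eq_bot_or_eq_bot_of_isCompl hn with h | h
  · left
    have h1 : Function.Injective (f ^ n) := LinearMap.ker_eq_bot.mp h
    obtain ⟨m, rfl⟩ : ∃ m, n = m + 1 := ⟨n - 1, by omega⟩
    have h2 : Function.Injective f := by
      rw [pow_succ, Module.End.mul_eq_comp, LinearMap.coe_comp] at h1
      exact h1.of_comp
    exact (Module.End.isUnit_iff f).mpr (IsArtinian.bijective_of_injective_endomorphism f h2)
  · exact Or.inr ⟨n, LinearMap.range_eq_bot.mp h⟩

/-- An endomorphism of an indecomposable module of finite length that fixes a nonzero map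
out of that module is invertible. -/
theorem CategoryTheory.Indecomposable.isIso_of_comp_eq {X Y : ModuleCat.{u} A}
    [IsArtinian A X] [IsNoetherian A X] (hX : Indecomposable X) (h : X ⟶ X) (f : X ⟶ Y)
    (hf : f ≠ 0) (hh : h ≫ f = f) : IsIso h := by
  have hh' : f.hom ∘ₗ h.hom = f.hom := by rw [← ModuleCat.hom_comp, hh]
  rcases hX.isUnit_or_isNilpotent h.hom with h1 | ⟨n, hn⟩
  · rw [Module.End.isUnit_iff] at h1
    exact (ConcreteCategory.isIso_iff_bijective h).mpr h1
  · exfalso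
    have key : ∀ m : ℕ, f.hom ∘ₗ (h.hom ^ m : Module.End A X) = f.hom := by
      intro m
      induction m with
      | zero => ext; simp
      | succ m ih =>
        rw [pow_succ, Module.End.mul_eq_comp, ← LinearMap.comp_assoc, ih, hh']
    apply hf
    ext1
    rw [← key n, hn]
    simp

/-- A nonzero retract of an indecomposable object is the whole object. -/
theorem CategoryTheory.Indecomposable.isIso_of_isSplitMono {C : Type*} [Category* C] [Abelian C]
    {X Y : C} (hY : Indecomposable Y) (hX : ¬ Limits.IsZero X) (f : X ⟶ Y) [IsSplitMono f] :
    IsIso f := by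
  have hb := Limits.isBilimitBinaryBiconeOfIsSplitMonoOfCokernel
    (Limits.cokernelIsCokernel f)
  have e := Limits.biprod.uniqueUpToIso _ _ hb
  have h0 := (hY.2 _ _ e).resolve_left hX
  have : Epi f := Preadditive.epi_of_isZero_cokernel f h0
  exact isIso_of_epi_of_isSplitMono f

/-- Projective indecomposable modules that surject onto the same simple module are isomorphic, if
one of them has finite length. -/
theorem nonempty_iso_of_epi_of_simple {P Q S : ModuleCat.{u} A} [Simple S]
    [Projective P] [Projective Q] (hP : Indecomposable P) (hQ : Indecomposable Q)
    [IsArtinian A P] [IsNoetherian A P] (f : P ⟶ S) [Epi f] (g : Q ⟶ S) [Epi g] :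
    Nonempty (P ≅ Q) := by
  have hf : f ≠ 0 := fun h =>
    Simple.not_isZero S (Limits.IsZero.of_epi_eq_zero f h)
  -- Lifting `f` and `g` through each other gives an endomorphism of `P` over `S`. Its invertibility
  -- makes `P` a retract of `Q`, so `Q` needs no finiteness.
  have : IsIso (Projective.factorThru f g ≫ Projective.factorThru g f) :=
    hP.isIso_of_comp_eq _ f hf (by simp)
  have : IsSplitMono (Projective.factorThru f g) :=
    ⟨⟨⟨Projective.factorThru g f ≫ inv (Projective.factorThru f g ≫ Projective.factorThru g f),
      by rw [← Category.assoc, IsIso.hom_inv_id]⟩⟩⟩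
  have := hQ.isIso_of_isSplitMono hP.1 (Projective.factorThru f g)
  exact ⟨asIso (Projective.factorThru f g)⟩

end Indecomposable

/-! ### Finite-dimensional projective covers of simple modules. -/

section FiniteDimensional

open ModuleCat

variable (K : Type v) [Field K] {A : Type u} [Ring A] [Algebra K A] [FiniteDimensional K A]

/-- A finitely generated module over a finite-dimensional algebra is finite-dimensional. -/
theorem ModuleCat.finiteDimensional_of_finite (X : ModuleCat.{u} A) [Module.Finite A X] :
    FiniteDimensional K X :=
  Module.Finite.trans A X

/-- Every simple module over a finite-dimensional algebra is a quotient of a finitely generated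
indecomposable projective module. -/
theorem exists_indecomposable_projective_epi (S : ModuleCat.{u} A) [Simple S] :
    ∃ (Q : ModuleCat.{u} A) (f : Q ⟶ S),
      Projective Q ∧ Indecomposable Q ∧ FiniteDimensional K Q ∧ Epi f := by
  classical
  -- A projective module of least dimension surjecting onto `S` is indecomposable: a summand on
  -- which `f` is nonzero already surjects onto `S`, so its complement has dimension zero.
  let p : ℕ → Prop := fun n => ∃ (Q : ModuleCat.{u} A) (f : Q ⟶ S),
    Projective Q ∧ FiniteDimensional K Q ∧ Epi f ∧ Module.finrank K Q = n
  have hp : ∃ n, p n := by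
    have := IsSimpleModule.nontrivial A S
    obtain ⟨x, hx⟩ := exists_ne (0 : S)
    refine ⟨_, ModuleCat.of A A, ModuleCat.ofHom (LinearMap.toSpanSingleton A S x),
      (IsProjective.iff_projective A).mp inferInstance,
      ModuleCat.finiteDimensional_of_finite K _, ?_, rfl⟩
    exact (ModuleCat.epi_iff_surjective _).mpr (IsSimpleModule.toSpanSingleton_surjective A hx)
  obtain ⟨Q, f, h1, h2, h3, h4⟩ := Nat.find_spec hp
  have hmin : ∀ (Y Z : ModuleCat.{u} A) (e : Q ≅ Y ⊞ Z), Limits.biprod.inl ≫ e.inv ≫ f ≠ 0 →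
      Limits.IsZero Z := by
    intro Y Z e hne
    have hY : Projective Y :=
      Retract.projective (Y := Q) ⟨Limits.biprod.inl ≫ e.inv, e.hom ≫ Limits.biprod.fst, by simp⟩
    let e' : Q ≅ ModuleCat.of A (Y × Z) := e ≪≫ ModuleCat.biprodIsoProd Y Z
    let e'' : Q ≃ₗ[K] (Y × Z) := e'.toLinearEquiv.restrictScalars K
    have hYZ : FiniteDimensional K (Y × Z) := e''.finiteDimensional
    have hYf : FiniteDimensional K Y :=
      Module.Finite.of_surjective (LinearMap.fst K Y Z) Prod.fst_surjective
    have hZf : FiniteDimensional K Z :=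
      Module.Finite.of_surjective (LinearMap.snd K Y Z) Prod.snd_surjective
    have hle := Nat.find_min' hp (m := Module.finrank K Y)
      ⟨Y, _, hY, hYf, epi_of_nonzero_to_simple hne, rfl⟩
    have h5 := e''.finrank_eq
    rw [Module.finrank_prod, h4] at h5
    have h6 : Module.finrank K Z = 0 := by omega
    have := Module.finrank_zero_iff.mp h6
    exact ModuleCat.isZero_of_subsingleton Z
  refine ⟨Q, f, h1, ⟨?_, ?_⟩, h2, h3⟩
  · intro h0
    exact Simple.not_isZero S (Limits.IsZero.of_epi f h0)
  · intro Y Z e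
    by_cases hY : Limits.biprod.inl ≫ e.inv ≫ f = 0
    · left
      refine hmin Z Y (e ≪≫ Limits.biprod.braiding Y Z) ?_
      intro hZ
      have : e.inv ≫ f = 0 := by
        apply Limits.biprod.hom_ext'
        · simpa using hY
        · have h7 : Limits.biprod.inl ≫ (Limits.biprod.braiding Y Z).inv = Limits.biprod.inr := by
            apply Limits.biprod.hom_ext <;> simp
          rw [Iso.trans_inv, Category.assoc, reassoc_of% h7] at hZ
          simpa using hZ
      have hf : f = 0 := by simpa using this
      exact Simple.not_isZero S (Limits.IsZero.of_epi_eq_zero f hf)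
    · exact Or.inr (hmin Y Z e hY)

end FiniteDimensional

/-! ### Induction on length, and linear forms on projective modules. -/

section FiniteLength

variable {A : Type u} [Ring A]

/-- The short complex given by a submodule and the quotient by it. -/
@[simps]
def Submodule.moduleCatShortComplex {M : Type u} [AddCommGroup M] [Module A M]
    (N : Submodule A M) : ShortComplex (ModuleCat.{u} A) where
  X₁ := ModuleCat.of A N
  X₂ := ModuleCat.of A M
  X₃ := ModuleCat.of A (M ⧸ N)
  f := ModuleCat.ofHom N.subtype
  g := ModuleCat.ofHom N.mkQ
  zero := by ext; simp

theorem Submodule.moduleCatShortComplex_shortExact {M : Type u} [AddCommGroup M] [Module A M]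
    (N : Submodule A M) : N.moduleCatShortComplex.ShortExact where
  exact := by
    rw [ShortComplex.ShortExact.moduleCat_exact_iff_function_exact]
    exact LinearMap.exact_subtype_mkQ N
  mono_f := (ModuleCat.mono_iff_injective _).mpr N.injective_subtype
  epi_g := (ModuleCat.epi_iff_surjective _).mpr N.mkQ_surjective

/-- Induction on the length of a module of finite length, in terms of short exact sequences. -/
theorem ModuleCat.induction_on_finiteLength {p : ModuleCat.{u} A → Prop}
    (zero : ∀ X : ModuleCat.{u} A, Limits.IsZero X → p X)
    (step : ∀ T : ShortComplex (ModuleCat.{u} A), T.ShortExact → IsFiniteLength A T.X₁ →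
      Simple T.X₃ → p T.X₁ → p T.X₂)
    (X : ModuleCat.{u} A) (hX : IsFiniteLength A X) : p X := by
  obtain ⟨M⟩ := X
  change IsFiniteLength A M at hX
  induction hX with
  | of_subsingleton => exact zero _ (ModuleCat.isZero_of_subsingleton _)
  | @of_simple_quotient M _ _ N _ h ih =>
    exact step N.moduleCatShortComplex N.moduleCatShortComplex_shortExact h
      (simple_of_isSimpleModule (M := M ⧸ N)) ih

/-- A nonzero projective module has a nonzero linear form. -/
theorem CategoryTheory.Projective.exists_ne_zero {P : ModuleCat.{u} A} [Projective P]
    (hP : ¬ Limits.IsZero P) : ∃ f : P ⟶ ModuleCat.of A A, f ≠ 0 := by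
  have : Module.Projective A P := (IsProjective.iff_projective P).mpr ‹_›
  -- The section `s` embeds `P` in a free module; some coordinate of `s x` is nonzero.
  obtain ⟨s, hs⟩ := Module.projective_def.mp this
  have : Nontrivial P := by
    by_contra h
    rw [not_nontrivial_iff_subsingleton] at h
    exact hP (ModuleCat.isZero_of_subsingleton P)
  obtain ⟨x, hx⟩ := exists_ne (0 : P)
  have hsx : s x ≠ 0 := fun h => hx (by rw [← hs x, h, map_zero])
  obtain ⟨y, hy⟩ := Finsupp.ne_iff.mp hsx
  refine ⟨ModuleCat.ofHom (Finsupp.lapply y ∘ₗ s), fun h => hy ?_⟩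
  exact congr($(h).hom x)

end FiniteLength

/-! ### Dimensions of `Hom` spaces. -/

section Hom

open ModuleCat

variable (K : Type v) [Field K] {A : Type u} [Ring A] [Algebra K A]

theorem ModuleCat.finiteDimensional_hom (X Y : ModuleCat.{u} A) [FiniteDimensional K X]
    [FiniteDimensional K Y] : FiniteDimensional K (X ⟶ Y) := by
  let F : (X ⟶ Y) →ₗ[K] (X →ₗ[K] Y) :=
    { toFun := fun f => f.hom.restrictScalars K
      map_add' := fun _ _ => rfl
      map_smul' := fun _ _ => rfl }
  refine Module.Finite.of_injective F fun f g h => ?_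
  ext x
  exact congr($h x)

/-- `Hom(P, -)` is additive on short exact sequences when `P` is projective. -/
theorem finrank_hom_add_of_shortExact {P : ModuleCat.{u} A} [Projective P]
    {T : ShortComplex (ModuleCat.{u} A)} (hT : T.ShortExact)
    [FiniteDimensional K (P ⟶ T.X₂)] :
    Module.finrank K (P ⟶ T.X₂) =
      Module.finrank K (P ⟶ T.X₁) + Module.finrank K (P ⟶ T.X₃) := by
  have := hT.mono_f
  have := hT.epi_g
  have h1 : Function.Injective (Linear.rightComp K P T.f) := fun a b h => by
    simpa [cancel_mono] using h
  have h2 : Function.Surjective (Linear.rightComp K P T.g) := fun a =>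
    ⟨Projective.factorThru a T.g, by simp⟩
  have h3 : LinearMap.range (Linear.rightComp K P T.f) =
      LinearMap.ker (Linear.rightComp K P T.g) := by
    ext a
    constructor
    · rintro ⟨b, rfl⟩
      simp
    · intro ha
      exact ⟨hT.exact.lift a ha, hT.exact.lift_f a ha⟩
  rw [← LinearMap.finrank_range_add_finrank_ker (Linear.rightComp K P T.g), ← h3,
    LinearMap.finrank_range_of_inj h1, LinearMap.range_eq_top.mpr h2, finrank_top, add_comm]

end Hom

/-! ### Maps from the `P i` to simple modules, and finiteness of `I`. -/

section Representatives

variable {K : Type v} [Field K] {A : Type u} [Ring A] [Algebra K A] {I : Type w}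
  {P S : I → ModuleCat.{u} A}

open ModuleCat

theorem IsFamilyOfRepresentatives.finiteDimensional [FiniteDimensional K A]
    (hP : IsFamilyOfRepresentatives (fun X => Projective X ∧ Indecomposable X) P)
    (hS : IsFamilyOfRepresentatives (fun X => Simple X) S)
    (hPS : ∀ i, ∃ f : P i ⟶ S i, Epi f) (i : I) : FiniteDimensional K (P i) := by
  obtain ⟨f, hf⟩ := hPS i
  have := hS.prop i
  obtain ⟨h1, h2⟩ := hP.prop i
  obtain ⟨Q, g, h3, h4, h5, h6⟩ := exists_indecomposable_projective_epi K (S i)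
  have : IsArtinian A Q := isArtinian_of_tower K inferInstance
  have : IsNoetherian A Q := isNoetherian_of_tower K inferInstance
  obtain ⟨e⟩ := nonempty_iso_of_epi_of_simple h4 h2 g f
  exact (e.toLinearEquiv.restrictScalars K).finiteDimensional

theorem IsFamilyOfRepresentatives.eq_of_hom_ne_zero
    (hP : IsFamilyOfRepresentatives (fun X => Projective X ∧ Indecomposable X) P)
    (hS : IsFamilyOfRepresentatives (fun X => Simple X) S)
    (hPS : ∀ i, ∃ f : P i ⟶ S i, Epi f) {i j : I} [FiniteDimensional K (P i)] {f : P i ⟶ S j}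
    (hf : f ≠ 0) : i = j := by
  obtain ⟨g, hg⟩ := hPS j
  have := hS.prop j
  obtain ⟨h1, h2⟩ := hP.prop i
  obtain ⟨h3, h4⟩ := hP.prop j
  have : IsArtinian A (P i) := isArtinian_of_tower K inferInstance
  have : IsNoetherian A (P i) := isNoetherian_of_tower K inferInstance
  have := epi_of_nonzero_to_simple hf
  exact hP.eq_of_iso _ _ (nonempty_iso_of_epi_of_simple h2 h4 f g)

/-- An indecomposable projective module of finite length has, up to scalars, at most one map to
a simple module. -/
theorem finrank_hom_simple [IsAlgClosed K] {P S : ModuleCat.{u} A} [Projective P]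
    (hP : Indecomposable P) [Simple S] [FiniteDimensional K P] (f : P ⟶ S) [Epi f] :
    Module.finrank K (P ⟶ S) = 1 := by
  have : IsArtinian A P := isArtinian_of_tower K inferInstance
  have : IsNoetherian A P := isNoetherian_of_tower K inferInstance
  have hf : f ≠ 0 := fun h => Simple.not_isZero S (Limits.IsZero.of_epi_eq_zero f h)
  have : Nontrivial P := by
    by_contra h
    rw [not_nontrivial_iff_subsingleton] at h
    exact hP.1 (ModuleCat.isZero_of_subsingleton P)
  refine finrank_eq_one f hf fun g => ?_
  let h : P ⟶ P := Projective.factorThru g f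
  have hh : h ≫ f = g := by simp [h]
  -- If `g ≠ c • f`, then `(h - c) ≫ f` is nonzero, hence epi. Lifting `f` through it gives an
  -- endomorphism whose composite with `h - c` fixes `f`, hence is invertible. So `h - c` is
  -- surjective, thus injective, although it kills the eigenvector `x`.
  obtain ⟨c, hc⟩ := Module.End.exists_eigenvalue (h.hom.restrictScalars K)
  obtain ⟨x, hx⟩ := hc.exists_hasEigenvector
  refine ⟨c, ?_⟩
  by_contra hne
  have hne' : (h - c • 𝟙 P) ≫ f ≠ 0 := by
    simp only [Preadditive.sub_comp, hh, Linear.smul_comp, Category.id_comp]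
    exact sub_ne_zero.mpr (Ne.symm hne)
  have := epi_of_nonzero_to_simple hne'
  have hiso := hP.isIso_of_comp_eq
    (Projective.factorThru f ((h - c • 𝟙 P) ≫ f) ≫ (h - c • 𝟙 P)) f hf
    (by rw [Category.assoc, Projective.factorThru_comp])
  have : Epi (h - c • 𝟙 P) := epi_of_epi (Projective.factorThru f ((h - c • 𝟙 P) ≫ f)) _
  have hs := (ModuleCat.epi_iff_surjective _).mp this
  have hi := IsNoetherian.injective_of_surjective_endomorphism _ hs
  apply hx.2
  apply hi
  have := hx.apply_eq_smul
  simp only [LinearMap.restrictScalars_apply] at this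
  simp [this]

/-- Each composition factor of a module of finite length accounts for at most one `i` with a nonzero
map from `P i`. Every `P i` maps nontrivially to `A`, which has finite length. -/
theorem IsFamilyOfRepresentatives.finite [FiniteDimensional K A]
    (hP : IsFamilyOfRepresentatives (fun X => Projective X ∧ Indecomposable X) P)
    (hS : IsFamilyOfRepresentatives (fun X => Simple X) S)
    (hPS : ∀ i, ∃ f : P i ⟶ S i, Epi f) (hK : ∀ i, FiniteDimensional K (P i)) : Finite I := by
  have key : ∀ X : ModuleCat.{u} A, IsFiniteLength A X → {i | ∃ f : P i ⟶ X, f ≠ 0}.Finite := by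
    refine ModuleCat.induction_on_finiteLength ?_ ?_
    · intro X hX
      convert Set.finite_empty
      ext i
      simpa using fun f => hX.eq_of_tgt f 0
    · intro T hT _ h3 h1
      obtain ⟨j, ⟨e⟩⟩ := hS.exists_iso _ h3
      refine (h1.union (Set.finite_singleton j)).subset ?_
      rintro i ⟨f, hf⟩
      have := hT.mono_f
      by_cases hg : f ≫ T.g = 0
      · left
        refine ⟨hT.exact.lift f hg, fun h => hf ?_⟩
        rw [← hT.exact.lift_f f hg, h, Limits.zero_comp]
      · right
        have : (f ≫ T.g) ≫ e.hom ≠ 0 := fun h =>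
          hg (by rwa [Preadditive.IsIso.comp_right_eq_zero] at h)
        exact hP.eq_of_hom_ne_zero (K := K) hS hPS this
  have : IsArtinian A A := isArtinian_of_tower K inferInstance
  have : IsNoetherian A A := isNoetherian_of_tower K inferInstance
  have h := key (ModuleCat.of A A) (isFiniteLength_iff_isNoetherian_isArtinian.mpr ⟨‹_›, ‹_›⟩)
  refine Set.finite_univ_iff.mp (h.subset fun i _ => ?_)
  have := (hP.prop i).1
  exact Projective.exists_ne_zero (hP.prop i).2.1

end Representatives

/-! ### Dimension counts in the long exact `Ext` sequence. -/

section Ext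

variable (K : Type v) [Field K] {C : Type*} [Category* C] [Abelian C] [Linear K C] [HasExt.{w} C]

open Module

/-- The rank of the connecting map `Extⁿ(X₁, Y) ⟶ Extⁿ⁺¹(X₃, Y)` of a short exact sequence. -/
noncomputable def connectingRank {T : ShortComplex C} (hT : T.ShortExact) (Y : C) (n : ℕ) : ℕ :=
  finrank K (LinearMap.range (hT.extClass.precompOfLinear K Y (add_comm 1 n)))

theorem ker_precomp_f {T : ShortComplex C} (hT : T.ShortExact) (Y : C) (n : ℕ) :
    LinearMap.ker ((Ext.mk₀ T.f).precompOfLinear K Y (zero_add n)) =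
      LinearMap.range ((Ext.mk₀ T.g).precompOfLinear K Y (zero_add n)) := by
  ext x
  constructor
  · exact fun hx => Ext.contravariant_sequence_exact₂ hT Y x hx
  · rintro ⟨y, rfl⟩
    simp

theorem ker_precomp_extClass {T : ShortComplex C} (hT : T.ShortExact) (Y : C) (n : ℕ) :
    LinearMap.ker (hT.extClass.precompOfLinear K Y (add_comm 1 n)) =
      LinearMap.range ((Ext.mk₀ T.f).precompOfLinear K Y (zero_add n)) := by
  ext x
  constructor
  · exact fun hx => Ext.contravariant_sequence_exact₁ hT Y x (add_comm 1 n) hx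
  · rintro ⟨y, rfl⟩
    simp

theorem ker_precomp_g {T : ShortComplex C} (hT : T.ShortExact) (Y : C) (n : ℕ) :
    LinearMap.ker ((Ext.mk₀ T.g).precompOfLinear K Y (zero_add (n + 1))) =
      LinearMap.range (hT.extClass.precompOfLinear K Y (add_comm 1 n)) := by
  ext x
  constructor
  · exact fun hx => Ext.contravariant_sequence_exact₃ hT Y x hx (add_comm 1 n)
  · rintro ⟨y, rfl⟩
    simp

/-- The part of the long exact sequence around `Extⁿ(X₂, Y)`, in terms of dimensions. -/
theorem finrank_ext_add {T : ShortComplex C} (hT : T.ShortExact) (Y : C) (n : ℕ)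
    [FiniteDimensional K (Ext T.X₁ Y n)] [FiniteDimensional K (Ext T.X₂ Y n)]
    [FiniteDimensional K (Ext T.X₃ Y n)] :
    finrank K (Ext T.X₁ Y n) + finrank K (Ext T.X₃ Y n) =
      finrank K (Ext T.X₂ Y n) + connectingRank K hT Y n +
        finrank K (LinearMap.ker ((Ext.mk₀ T.g).precompOfLinear K Y (zero_add n))) := by
  have h1 := LinearMap.finrank_range_add_finrank_ker
    (hT.extClass.precompOfLinear K Y (add_comm 1 n))
  have h2 := LinearMap.finrank_range_add_finrank_ker
    ((Ext.mk₀ T.f).precompOfLinear K Y (zero_add n))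
  have h3 := LinearMap.finrank_range_add_finrank_ker
    ((Ext.mk₀ T.g).precompOfLinear K Y (zero_add n))
  rw [ker_precomp_extClass] at h1
  rw [ker_precomp_f K hT] at h2
  unfold connectingRank
  omega

theorem finrank_ker_precomp_g_zero {T : ShortComplex C} (hT : T.ShortExact) (Y : C) :
    finrank K (LinearMap.ker ((Ext.mk₀ T.g).precompOfLinear K Y (zero_add 0))) = 0 := by
  have := hT.epi_g
  rw [LinearMap.ker_eq_bot.mpr, finrank_bot]
  exact Ext.precomp_mk₀_injective_of_epi Y T.g

/-- The alternating sum of the long exact sequence. -/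
theorem sum_range_finrank_ext {T : ShortComplex C} (hT : T.ShortExact) (Y : C)
    (h1 : ∀ n, FiniteDimensional K (Ext T.X₁ Y n)) (h2 : ∀ n, FiniteDimensional K (Ext T.X₂ Y n))
    (h3 : ∀ n, FiniteDimensional K (Ext T.X₃ Y n)) (N : ℕ) :
    ∑ n ∈ Finset.range (N + 1), (-1 : ℤ) ^ n * finrank K (Ext T.X₁ Y n) +
      ∑ n ∈ Finset.range (N + 1), (-1 : ℤ) ^ n * finrank K (Ext T.X₃ Y n) =
    ∑ n ∈ Finset.range (N + 1), (-1 : ℤ) ^ n * finrank K (Ext T.X₂ Y n) +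
      (-1 : ℤ) ^ N * connectingRank K hT Y N := by
  have key (n : ℕ) : (finrank K (Ext T.X₁ Y n) : ℤ) + finrank K (Ext T.X₃ Y n) =
      finrank K (Ext T.X₂ Y n) + connectingRank K hT Y n +
        finrank K (LinearMap.ker ((Ext.mk₀ T.g).precompOfLinear K Y (zero_add n))) := by
    exact_mod_cast finrank_ext_add K hT Y n
  induction N with
  | zero =>
    have := key 0
    rw [finrank_ker_precomp_g_zero K hT] at this
    simpa using this
  | succ N ih =>
    have h := key (N + 1)
    -- By exactness the kernel term in degree `N + 1` is the connecting rank in degree `N`, so the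
    -- alternating sum telescopes.
    rw [ker_precomp_g K hT] at h
    change _ = _ + (connectingRank K hT Y N : ℤ) at h
    simp only [Finset.sum_range_succ _ (N + 1)]
    rw [pow_succ]
    linear_combination ih - (-1 : ℤ) ^ N * h

/-- Dimension shifting: the connecting map is onto because `Ext` from `T.X₂` vanishes in positive
degrees. -/
theorem finiteDimensional_ext_succ {T : ShortComplex C} (hT : T.ShortExact) [Projective T.X₂]
    (Y : C) (n : ℕ) [FiniteDimensional K (Ext T.X₁ Y n)] :
    FiniteDimensional K (Ext T.X₃ Y (n + 1)) := by
  refine Module.Finite.of_surjective (hT.extClass.precompOfLinear K Y (add_comm 1 n)) fun x => ?_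
  exact Ext.contravariant_sequence_exact₃ hT Y x (Ext.eq_zero_of_projective _) (add_comm 1 n)

theorem CategoryTheory.ProjectiveResolution.subsingleton_ext {X : C}
    (Q : ProjectiveResolution X) {n : ℕ} (h : Limits.IsZero (Q.complex.X n)) (Y : C) :
    Subsingleton (Ext X Y n) := by
  refine subsingleton_of_forall_eq 0 fun α => ?_
  obtain ⟨f, hf, rfl⟩ := Q.extMk_surjective α (n + 1) rfl
  obtain rfl := h.eq_of_src f 0
  exact Q.extMk_zero _ _

end Ext

/-! ### Additivity and special values of the Euler form. -/

section EulerForm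

variable (K : Type v) [Field K] {A : Type u} [Ring A] [Algebra K A]

theorem HasFiniteGlobalDimension.exists_subsingleton_ext (hA : HasFiniteGlobalDimension A) :
    ∃ N : ℕ, ∀ (X Y : ModuleCat.{u} A) (n : ℕ), N < n → Subsingleton (Ext X Y n) := by
  obtain ⟨N, hN⟩ := hA
  refine ⟨N, fun X Y n hn => ?_⟩
  obtain ⟨Q, hQ⟩ := hN X
  exact Q.subsingleton_ext (hQ n hn) Y

theorem eulerForm_eq_sum_range {X Y : ModuleCat.{u} A} {N : ℕ}
    (hN : ∀ n, N < n → Subsingleton (Ext X Y n)) :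
    eulerForm K X Y =
      ∑ n ∈ Finset.range (N + 1), (-1 : ℤ) ^ n * Module.finrank K (Ext X Y n) := by
  refine finsum_eq_sum_of_support_subset _ fun n hn => ?_
  by_contra h
  have : N < n := by simpa [Nat.lt_succ_iff] using h
  have := hN n this
  simp [Module.finrank_zero_of_subsingleton] at hn

theorem eulerForm_of_isZero {X : ModuleCat.{u} A} (hX : Limits.IsZero X) (Y : ModuleCat.{u} A) :
    eulerForm K X Y = 0 := by
  have h (n : ℕ) : Subsingleton (Ext X Y n) :=
    have := hX.hasProjectiveDimensionLT_zero
    HasProjectiveDimensionLT.subsingleton X 0 n (Nat.zero_le n) Y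
  simp [eulerForm, Module.finrank_zero_of_subsingleton]

theorem eulerForm_of_projective (X : ModuleCat.{u} A) [Projective X] (Y : ModuleCat.{u} A) :
    eulerForm K X Y = Module.finrank K (X ⟶ Y) := by
  rw [eulerForm_eq_sum_range K (N := 0) fun n hn =>
    HasProjectiveDimensionLT.subsingleton X 1 n hn Y]
  simp [(Ext.linearEquiv₀ (R := K) (X := X) (Y := Y)).finrank_eq]

/-- The Euler form is additive in its first argument. -/
theorem eulerForm_of_shortExact (hA : HasFiniteGlobalDimension A)
    {T : ShortComplex (ModuleCat.{u} A)} (hT : T.ShortExact) (Y : ModuleCat.{u} A)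
    (h1 : ∀ n, FiniteDimensional K (Ext T.X₁ Y n)) (h2 : ∀ n, FiniteDimensional K (Ext T.X₂ Y n))
    (h3 : ∀ n, FiniteDimensional K (Ext T.X₃ Y n)) :
    eulerForm K T.X₂ Y = eulerForm K T.X₁ Y + eulerForm K T.X₃ Y := by
  obtain ⟨N, hN⟩ := hA.exists_subsingleton_ext
  have h := sum_range_finrank_ext K hT Y h1 h2 h3 N
  -- The one boundary term left after truncation is the rank of a map into degree `N + 1`, where
  -- `Ext` vanishes.
  have hr : connectingRank K hT Y N = 0 := by
    have := hN T.X₃ Y (N + 1) (Nat.lt_succ_self N)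
    exact Module.finrank_zero_of_subsingleton
  rw [eulerForm_eq_sum_range K (hN T.X₁ Y), eulerForm_eq_sum_range K (hN T.X₂ Y),
    eulerForm_eq_sum_range K (hN T.X₃ Y), h, hr]
  simp

theorem eulerForm_of_iso {X X' : ModuleCat.{u} A} (e : X ≅ X') (Y : ModuleCat.{u} A) :
    eulerForm K X Y = eulerForm K X' Y := by
  unfold eulerForm
  refine finsum_congr fun n => ?_
  have : Module.finrank K (Ext X Y n) = Module.finrank K (Ext X' Y n) := by
    refine LinearEquiv.finrank_eq (LinearEquiv.ofLinearMap
      ((Ext.mk₀ e.inv).precompOfLinear K Y (zero_add n))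
      ((Ext.mk₀ e.hom).precompOfLinear K Y (zero_add n)) ?_ ?_) <;> ext x <;> simp
  rw [this]

end EulerForm

/-! ### Finiteness of `Ext`, the multiplicity formula and the matrix identity. -/

section Main

open ModuleCat

variable (K : Type v) [Field K] {A : Type u} [Ring A] [Algebra K A]

theorem ModuleCat.finiteDimensional_of_simple [FiniteDimensional K A] {X : ModuleCat.{u} A}
    (hX : Simple X) : FiniteDimensional K X := by
  have : Module.Finite A X := inferInstance
  exact ModuleCat.finiteDimensional_of_finite K X

/-- `Ext` between finitely generated modules over a finite-dimensional algebra is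
finite-dimensional. -/
theorem ModuleCat.finiteDimensional_ext [FiniteDimensional K A] (X Y : ModuleCat.{u} A)
    [FiniteDimensional K X] [FiniteDimensional K Y] (n : ℕ) :
    FiniteDimensional K (Ext X Y n) := by
  induction n generalizing X with
  | zero =>
    have := ModuleCat.finiteDimensional_hom K X Y
    exact (Ext.linearEquiv₀ (R := K) (X := X) (Y := Y)).symm.finiteDimensional
  | succ n ih =>
    have : Module.Finite A X := Module.Finite.of_restrictScalars_finite K A X
    -- A finite free cover shifts degree `n + 1` of `X` to degree `n` of the kernel, which is again
    -- finitely generated because `A` is Noetherian.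
    obtain ⟨m, f, hf⟩ := Module.Finite.exists_fin' A X
    have hT := (LinearMap.ker f).moduleCatShortComplex_shortExact
    have hK : FiniteDimensional K (LinearMap.ker f).moduleCatShortComplex.X₁ := by
      have : IsNoetherian A A := isNoetherian_of_tower K inferInstance
      have : Module.Finite A (LinearMap.ker f).moduleCatShortComplex.X₁ :=
        inferInstanceAs (Module.Finite A (LinearMap.ker f))
      exact ModuleCat.finiteDimensional_of_finite K _
    have : Projective (LinearMap.ker f).moduleCatShortComplex.X₂ :=
      (IsProjective.iff_projective (Fin m → A)).mp inferInstance
    have := ih (LinearMap.ker f).moduleCatShortComplex.X₁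
    have := finiteDimensional_ext_succ K hT Y n
    let e : (LinearMap.ker f).moduleCatShortComplex.X₃ ≅ X :=
      (f.quotKerEquivOfSurjective hf).toModuleIso
    refine Module.Finite.of_surjective
      ((Ext.mk₀ e.inv).precompOfLinear K Y (zero_add (n + 1))) fun x => ?_
    exact ⟨(Ext.mk₀ e.hom).comp x (zero_add _), by simp⟩

variable [FiniteDimensional K A] {I : Type w} {P S : I → ModuleCat.{u} A}

theorem IsFamilyOfRepresentatives.finrank_hom [IsAlgClosed K] [DecidableEq I]
    (hP : IsFamilyOfRepresentatives (fun X => Projective X ∧ Indecomposable X) P)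
    (hS : IsFamilyOfRepresentatives (fun X => Simple X) S)
    (hPS : ∀ i, ∃ f : P i ⟶ S i, Epi f) (i j : I) :
    Module.finrank K (P i ⟶ S j) = if i = j then 1 else 0 := by
  have hPfin : FiniteDimensional K (P i) := hP.finiteDimensional hS hPS i
  obtain ⟨h1, h2⟩ := hP.prop i
  have h3 := hS.prop j
  split_ifs with h
  · subst h
    obtain ⟨f, hf⟩ := hPS i
    exact finrank_hom_simple h2 f
  · have : Subsingleton (P i ⟶ S j) := subsingleton_of_forall_eq 0 fun f => by
      by_contra hf
      exact h (hP.eq_of_hom_ne_zero (K := K) hS hPS hf)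
    exact Module.finrank_zero_of_subsingleton

/-- The Euler form is determined in its first argument by the composition multiplicities. -/
theorem eulerForm_eq_sum_finrank_hom [IsAlgClosed K] (hA : HasFiniteGlobalDimension A)
    [Fintype I]
    (hP : IsFamilyOfRepresentatives (fun X => Projective X ∧ Indecomposable X) P)
    (hS : IsFamilyOfRepresentatives (fun X => Simple X) S)
    (hPS : ∀ i, ∃ f : P i ⟶ S i, Epi f) (Y X : ModuleCat.{u} A)
    [FiniteDimensional K X] [FiniteDimensional K Y] :
    eulerForm K X Y = ∑ i, (Module.finrank K (P i ⟶ X) : ℤ) * eulerForm K (S i) Y := by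
  classical
  have hPfin (i) : FiniteDimensional K (P i) := hP.finiteDimensional hS hPS i
  have hPproj (i) : Projective (P i) := (hP.prop i).1
  have hfin (M : ModuleCat.{u} A) (hM : IsFiniteLength A M) : FiniteDimensional K M := by
    obtain ⟨_, _⟩ := isFiniteLength_iff_isNoetherian_isArtinian.mp hM
    exact ModuleCat.finiteDimensional_of_finite K M
  suffices h : ∀ X : ModuleCat.{u} A, IsFiniteLength A X →
      eulerForm K X Y = ∑ i, (Module.finrank K (P i ⟶ X) : ℤ) * eulerForm K (S i) Y by
    have : IsArtinian A X := isArtinian_of_tower K inferInstance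
    have : IsNoetherian A X := isNoetherian_of_tower K inferInstance
    exact h X (isFiniteLength_iff_isNoetherian_isArtinian.mpr ⟨‹_›, ‹_›⟩)
  refine ModuleCat.induction_on_finiteLength (fun X hX => ?_) fun T hT h1 h3 ih => ?_
  · rw [eulerForm_of_isZero K hX, Finset.sum_eq_zero]
    intro i _
    have : Subsingleton (P i ⟶ X) := ⟨fun f g => hX.eq_of_tgt f g⟩
    rw [Module.finrank_zero_of_subsingleton, Nat.cast_zero, zero_mul]
  · obtain ⟨j, ⟨e⟩⟩ := hS.exists_iso _ h3
    have hf1 : FiniteDimensional K T.X₁ := hfin _ h1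
    have hf3 : FiniteDimensional K T.X₃ := ModuleCat.finiteDimensional_of_simple K h3
    have hf2 : FiniteDimensional K T.X₂ := by
      have hexact : Function.Exact (T.f.hom.restrictScalars K) (T.g.hom.restrictScalars K) :=
        (ShortComplex.ShortExact.moduleCat_exact_iff_function_exact T).mp hT.exact
      exact Module.Finite.of_exact hexact ((ModuleCat.epi_iff_surjective T.g).mp hT.epi_g)
    -- For the simple quotient `T.X₃ ≅ S j`, only the summand at `j` survives.
    have hS3 : ∑ i, (Module.finrank K (P i ⟶ T.X₃) : ℤ) * eulerForm K (S i) Y =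
        eulerForm K T.X₃ Y := by
      rw [eulerForm_of_iso K e, Finset.sum_eq_single j]
      · rw [(Linear.homCongr K (Iso.refl (P j)) e).finrank_eq, hP.finrank_hom K hS hPS]
        simp
      · intro i _ hij
        rw [(Linear.homCongr K (Iso.refl (P i)) e).finrank_eq, hP.finrank_hom K hS hPS,
          if_neg hij, Nat.cast_zero, zero_mul]
      · simp
    rw [eulerForm_of_shortExact K hA hT Y (ModuleCat.finiteDimensional_ext K _ Y)
      (ModuleCat.finiteDimensional_ext K _ Y) (ModuleCat.finiteDimensional_ext K _ Y), ih,
      ← hS3, ← Finset.sum_add_distrib]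
    refine Finset.sum_congr rfl fun i _ => ?_
    have := ModuleCat.finiteDimensional_hom K (P i) T.X₂
    rw [finrank_hom_add_of_shortExact K hT]
    push_cast
    ring

theorem IsFamilyOfRepresentatives.eulerMatrix_mul_cartanMatrix [IsAlgClosed K]
    (hA : HasFiniteGlobalDimension A) [Fintype I] [DecidableEq I]
    (hP : IsFamilyOfRepresentatives (fun X => Projective X ∧ Indecomposable X) P)
    (hS : IsFamilyOfRepresentatives (fun X => Simple X) S)
    (hPS : ∀ i, ∃ f : P i ⟶ S i, Epi f) : eulerMatrix K S * cartanMatrix K P = 1 := by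
  ext k j
  have hPfin (i) : FiniteDimensional K (P i) := hP.finiteDimensional hS hPS i
  have hSfin (i) : FiniteDimensional K (S i) := ModuleCat.finiteDimensional_of_simple K (hS.prop i)
  have hPproj (i) : Projective (P i) := (hP.prop i).1
  have h : eulerForm K (P j) (S k) = (1 : Matrix I I ℤ) k j := by
    rw [eulerForm_of_projective, hP.finrank_hom K hS hPS, Matrix.one_apply]
    simp [eq_comm]
  rw [← h, eulerForm_eq_sum_finrank_hom K hA hP hS hPS, Matrix.mul_apply]
  exact Finset.sum_congr rfl fun i _ => mul_comm _ _

theorem IsFamilyOfRepresentatives.finiteDimensional_hom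
    (hP : IsFamilyOfRepresentatives (fun X => Projective X ∧ Indecomposable X) P)
    (hS : IsFamilyOfRepresentatives (fun X => Simple X) S)
    (hPS : ∀ i, ∃ f : P i ⟶ S i, Epi f) (i j : I) : FiniteDimensional K (P i ⟶ P j) :=
  have (i : I) : FiniteDimensional K (P i) := hP.finiteDimensional hS hPS i
  ModuleCat.finiteDimensional_hom K _ _

theorem IsFamilyOfRepresentatives.finiteDimensional_ext
    (hS : IsFamilyOfRepresentatives (fun X => Simple X) S) (i j : I) (n : ℕ) :
    FiniteDimensional K (Ext (S i) (S j) n) :=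
  have (i : I) : FiniteDimensional K (S i) := ModuleCat.finiteDimensional_of_simple K (hS.prop i)
  ModuleCat.finiteDimensional_ext K _ _ n

end Main

theorem theorem2 {K : Type v} [Field K] [IsAlgClosed K]
    {A : Type u} [Ring A] [Algebra K A] [FiniteDimensional K A]
    (hA : HasFiniteGlobalDimension A)
    {I : Type w} (P S : I → ModuleCat.{u} A)
    (hP : IsFamilyOfRepresentatives (fun X => Projective X ∧ Indecomposable X) P)
    (hS : IsFamilyOfRepresentatives (fun X => Simple X) S)
    (hPS : ∀ i, ∃ f : P i ⟶ S i, Epi f) :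
    -- the index set is finite, and the dimensions and sums in the two matrices are finite
    Finite I ∧
    (∀ i j, FiniteDimensional K (P i ⟶ P j)) ∧
    (∀ i j n, FiniteDimensional K (Ext (S i) (S j) n)) ∧
    (∃ N : ℕ, ∀ i j n, N < n → Subsingleton (Ext (S i) (S j) n)) ∧
    -- `Z_A` is invertible over `ℤ`, with inverse `E_A`
    (∀ [Fintype I] [DecidableEq I],
      IsUnit (cartanMatrix K P) ∧ (cartanMatrix K P)⁻¹ = eulerMatrix K S) := by
  have key [Fintype I] [DecidableEq I] : eulerMatrix K S * cartanMatrix K P = 1 :=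
    hP.eulerMatrix_mul_cartanMatrix K hA hS hPS
  obtain ⟨N, hN⟩ := hA.exists_subsingleton_ext
  exact ⟨hP.finite hS hPS fun i => hP.finiteDimensional (K := K) hS hPS i,
    hP.finiteDimensional_hom K hS hPS, hS.finiteDimensional_ext K,
    ⟨N, fun i j n hn => hN _ _ n hn⟩,
    -- For square matrices over a commutative ring a one-sided inverse is two-sided.
    IsUnit.of_mul_eq_one_right _ key, Matrix.inv_eq_left_inv key⟩
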